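/- Let $k \ge 2$ be an integer, and let $G$ be a finite simple undirected graph of order $n \ge 6k+12-2\left\lceil \frac{k-2}{k} \right\rceil$ with minimum degree $\delta(G) \ge \frac{n}{2}$. Suppose that $G$ is $k$-connected, i.e. its connectivity $\kappa(G)$ (the least number of vertices whose deletion leaves a disconnected graph or a single vertex) is at least $k$. Then $G$ contains a Hamiltonian cycle $H$ such that $G-E(H)$, the graph obtained from $G$ by deleting every edge of $H$ and keeping all vertices, is $k$-connected. -/

import Mathlib

namespace DiracConn

/-- The (vertex) connectivity `κ(G)` of a finite graph: the least number of vertices whose deletion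
leaves a graph that is disconnected or has exactly one vertex. In particular `κ(G) = 0` for a
disconnected graph and `κ(Kₙ) = n - 1`. Only proper subsets `S` of the vertex set are deleted,
and `G - S` is the subgraph induced on the vertices outside `S`. -/
noncomputable def vertexConnectivity {V : Type*} [Fintype V] (G : SimpleGraph V) : ℕ :=
  sInf {m : ℕ | ∃ S : Finset V, S ≠ Finset.univ ∧ S.card = m ∧
    (¬ (G.induce {v : V | v ∉ S}).Connected ∨ S.card + 1 = Fintype.card V)}

/-- A finite graph is `k`-connected if its connectivity is at least `k`. -/
def IsKConnected {V : Type*} [Fintype V] (k : ℕ) (G : SimpleGraph V) : Prop :=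
  k ≤ vertexConnectivity G

end DiracConn

/-! A Hamiltonian cycle H uses two edges at each vertex. A separation (A, T, B) of G - E(H) with |T|
< k therefore leaves at most two G-edges from each vertex of A to B, and conversely: it is thin
(`IsThin`). If G has no thin tripartition, any Dirac cycle works.

Otherwise fix a thin (A, T, B). The degree bound makes A and B dense, of size about n/2, so every
other thin tripartition agrees with it up to swapping sides (`IsThin.compare`). Let X and Y be the
vertices sparse to B and to A, and Z the rest. Every thin (A', T', B'), suitably oriented, has A' ⊆
X, B' ⊆ Y and Z ⊆ T' (`IsThin.subset_of_disjoint`). By König's theorem and k-connectedness there are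
k - |Z| disjoint X-Y edges (`IsThin.exists_matching`). If H avoids them, then T' contains Z and an
end of each of them, so |T'| ≥ k.

To avoid them, H crosses between Y and its complement exactly twice, along disjoint edges whose ends
outside Y miss the matching (`IsThin.exists_disjoint_edges`). Both sides are traversed by
Hamiltonian paths with prescribed ends, obtained by a closure argument (`exists_ham_path`). -/

namespace DiracConn

open Finset

/-! ### Hamiltonian cycles and paths by Bondy–Chvátal closure. -/

section Hamiltonian

variable {V : Type*}

open Classical in
/-- The number of neighbours of `v` in `S`. -/
noncomputable def degOn (G : SimpleGraph V) (S : Finset V) (v : V) : ℕ := (S.filter (G.Adj v)).card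

/-- There is a Hamiltonian cycle of `G`, given as a Hamiltonian path from `a` to `b` closed by the
edge `ab`, whose edges include all of `F`. -/
def HamThrough (G : SimpleGraph V) (F : Finset (Sym2 V)) : Prop :=
  ∃ (a b : V) (p : G.Walk a b), p.IsPath ∧ (∀ w, w ∈ p.support) ∧ G.Adj b a ∧
    ∀ e ∈ F, e = s(a, b) ∨ e ∈ p.edges

theorem walk_split {G : SimpleGraph V} {a b : V} (p : G.Walk a b) (i : ℕ) (hi : i < p.length) :
    ∃ (x y : V) (h : G.Adj x y) (q : G.Walk a x) (r : G.Walk y b),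
      p = q.append (.cons h r) ∧ x = p.getVert i ∧ y = p.getVert (i + 1) := by
  induction p generalizing i with
  | nil => simp at hi
  | @cons a c b h p ih =>
    cases i with
    | zero => exact ⟨a, c, h, .nil, p, by simp⟩
    | succ i =>
      obtain ⟨x, y, hxy, q, r, rfl, hx, hy⟩ := ih i (by simpa using hi)
      exact ⟨x, y, hxy, .cons h q, r, by simp, by simpa using hx, by simpa using hy⟩

theorem walk_split_of_mem_edges {G : SimpleGraph V} {a b : V} (p : G.Walk a b) {e : Sym2 V}
    (he : e ∈ p.edges) :
    ∃ (x y : V) (h : G.Adj x y) (q : G.Walk a x) (r : G.Walk y b),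
      p = q.append (.cons h r) ∧ e = s(x, y) := by
  induction p with
  | nil => simp at he
  | @cons a c b h p ih =>
    rw [SimpleGraph.Walk.edges_cons, List.mem_cons] at he
    rcases he with rfl | he
    · exact ⟨a, c, h, .nil, p, by simp⟩
    · obtain ⟨x, y, hxy, q, r, rfl, hx⟩ := ih he
      exact ⟨x, y, hxy, .cons h q, r, by simp, hx⟩

theorem support_append_cons {G : SimpleGraph V} {a b x y : V} (h : G.Adj x y) (q : G.Walk a x)
    (r : G.Walk y b) : (q.append (.cons h r)).support = q.support ++ r.support := by
  rw [SimpleGraph.Walk.support_append]; simp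

/-- A path containing the edge between its own ends is just that edge. This excludes the degenerate
closed walk that runs along one edge and back. -/
theorem card_le_two_of_edge_mem [Fintype V] {G : SimpleGraph V} {a b : V} {p : G.Walk a b}
    (hp : p.IsPath) (hall : ∀ w, w ∈ p.support) (he : s(a, b) ∈ p.edges) :
    Fintype.card V ≤ 2 := by
  classical
  obtain ⟨x, y, h, q, r, rfl, hxy⟩ := walk_split_of_mem_edges p he
  rw [SimpleGraph.Walk.isPath_def, support_append_cons, List.nodup_append] at hp
  rw [support_append_cons] at hall
  rcases Sym2.eq_iff.1 hxy with ⟨rfl, rfl⟩ | ⟨rfl, rfl⟩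
  · have hq := SimpleGraph.Walk.isPath_iff_nil.1 ((SimpleGraph.Walk.isPath_def q).2 hp.1)
    have hr := SimpleGraph.Walk.isPath_iff_nil.1 ((SimpleGraph.Walk.isPath_def r).2 hp.2.1)
    rw [← SimpleGraph.Walk.eq_nil_iff_nil] at hq hr
    subst hq hr
    have : (univ : Finset V) ⊆ {a, b} := fun w _ => by simpa using hall w
    exact (card_le_card this).trans card_le_two
  · exact absurd rfl (hp.2.2 _ q.start_mem_support _ r.start_mem_support)

/-- Either the cycle avoids uv and lives in G, or cutting it at uv leaves a Hamiltonian path. The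
edge uv may be the closing edge or an inner edge of the stored path; in the latter case the cycle is
rotated. -/
theorem hamThrough_or_path_of_sup_edge [Fintype V] {G : SimpleGraph V} {u v : V}
    {F : Finset (Sym2 V)} (hV : 3 ≤ Fintype.card V) (h : HamThrough (G ⊔ SimpleGraph.edge u v) F) :
    HamThrough G F ∨ ∃ p : G.Walk u v, p.IsPath ∧ (∀ w, w ∈ p.support) ∧
      ∀ e ∈ F, e = s(u, v) ∨ e ∈ p.edges := by
  obtain ⟨a, b, p, hp, hall, hba, hF⟩ := h
  have key : ∀ e ∈ (G ⊔ SimpleGraph.edge u v).edgeSet, e ≠ s(u, v) → e ∈ G.edgeSet := by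
    intro e
    induction e with | h x y =>
    intro h hne
    rw [SimpleGraph.mem_edgeSet, SimpleGraph.sup_adj, SimpleGraph.edge_adj] at h
    rcases h with h | h
    · exact h
    · exact absurd (Sym2.eq_iff.2 h.1) hne
  by_cases hab : s(a, b) = s(u, v)
  · right
    have hn : ∀ e ∈ p.edges, e ∈ G.edgeSet := fun e he => key e (p.edges_subset_edgeSet he) (by
      rintro rfl
      rw [← hab] at he
      have := card_le_two_of_edge_mem hp hall he
      omega)
    rw [hab] at hF
    rcases Sym2.eq_iff.1 hab with ⟨rfl, rfl⟩ | ⟨rfl, rfl⟩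
    · exact ⟨p.transfer G hn, hp.transfer hn, by simpa using hall, by simpa using hF⟩
    · exact ⟨(p.transfer G hn).reverse, (hp.transfer hn).reverse, by simpa using hall,
        by simpa using hF⟩
  · have hba' : G.Adj b a := key s(b, a) hba (by rwa [Sym2.eq_swap])
    by_cases hmem : s(u, v) ∈ p.edges
    · right
      obtain ⟨x, y, h, q, r, rfl, hxy⟩ := walk_split_of_mem_edges p hmem
      have hnd := hp.edges_nodup
      have hnd2 := (SimpleGraph.Walk.isPath_def _).1 hp
      rw [support_append_cons] at hnd2 hall
      rw [SimpleGraph.Walk.edges_append, SimpleGraph.Walk.edges_cons, List.nodup_append] at hnd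
      have hq : ∀ e ∈ q.edges, e ∈ G.edgeSet := fun e he => key e (q.edges_subset_edgeSet he) (by
        rintro rfl
        exact hnd.2.2 _ he _ (by simp) hxy)
      have hr : ∀ e ∈ r.edges, e ∈ G.edgeSet := fun e he => key e (r.edges_subset_edgeSet he) (by
        rintro rfl
        exact (List.nodup_cons.1 hnd.2.1).1 (hxy ▸ he))
      let w : G.Walk y x := (r.transfer G hr).append (.cons hba' (q.transfer G hq))
      have hws : w.support = r.support ++ q.support := by
        simp only [w, support_append_cons, SimpleGraph.Walk.support_transfer]
      have hw : w.IsPath := by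
        rw [SimpleGraph.Walk.isPath_def, hws]
        exact List.nodup_append_comm.1 hnd2
      have hwall : ∀ z, z ∈ w.support := by
        intro z
        rw [hws]
        simpa [or_comm] using hall z
      have hwF : ∀ e ∈ F, e = s(u, v) ∨ e ∈ w.edges := by
        intro e he
        have := hF e he
        simp only [w, SimpleGraph.Walk.edges_append, SimpleGraph.Walk.edges_cons, List.mem_append,
          List.mem_cons, SimpleGraph.Walk.edges_transfer] at this ⊢
        rw [hxy, Sym2.eq_swap (a := b)]
        tauto
      rcases Sym2.eq_iff.1 hxy with ⟨rfl, rfl⟩ | ⟨rfl, rfl⟩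
      · exact ⟨w.reverse, hw.reverse, by simpa using hwall, by simpa using hwF⟩
      · exact ⟨w, hw, hwall, hwF⟩
    · left
      have hn : ∀ e ∈ p.edges, e ∈ G.edgeSet := fun e he => key e (p.edges_subset_edgeSet he) (by
        rintro rfl; exact hmem he)
      exact ⟨a, b, p.transfer G hn, hp.transfer hn, by simpa using hall, hba', by simpa using hF⟩

theorem length_add_one_eq_card [Fintype V] {G : SimpleGraph V} {u v : V} {p : G.Walk u v}
    (hp : p.IsPath) (hall : ∀ w, w ∈ p.support) : p.length + 1 = Fintype.card V := by
  classical
  rw [← SimpleGraph.Walk.length_support, ← List.toFinset_card_of_nodup hp.support_nodup,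
    ← card_univ]
  congr 1
  ext w
  simp [hall]

/-- The crossing argument of Ore and Bondy–Chvátal. -/
theorem hamThrough_of_path [Fintype V] {G : SimpleGraph V} {u v : V} {F : Finset (Sym2 V)}
    (p : G.Walk u v) (hp : p.IsPath) (hall : ∀ w, w ∈ p.support) (hF : ∀ e ∈ F, e ∈ p.edges)
    (hdeg : Fintype.card V + F.card ≤ degOn G univ u + degOn G univ v) : HamThrough G F := by
  classical
  have hlen := length_add_one_eq_card hp hall
  set I := range p.length
  set S := I.filter fun i => G.Adj u (p.getVert (i + 1))
  set T := I.filter fun i => G.Adj v (p.getVert i)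
  set R := I.filter fun i => s(p.getVert i, p.getVert (i + 1)) ∈ F
  have hS : degOn G univ u ≤ S.card := by
    refine (card_le_card (t := S.image fun i => p.getVert (i + 1)) ?_).trans card_image_le
    intro w hw
    have hw : G.Adj u w := by simpa using hw
    obtain ⟨j, rfl, hj⟩ := SimpleGraph.Walk.mem_support_iff_exists_getVert.1 (hall w)
    have hj0 : j ≠ 0 := by rintro rfl; simp at hw
    obtain ⟨i, rfl⟩ := Nat.exists_eq_succ_of_ne_zero hj0
    exact mem_image.2 ⟨i, by simpa [S, I, hw] using hj, rfl⟩
  have hT : degOn G univ v ≤ T.card := by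
    refine (card_le_card (t := T.image fun i => p.getVert i) ?_).trans card_image_le
    intro w hw
    have hw : G.Adj v w := by simpa using hw
    obtain ⟨j, rfl, hj⟩ := SimpleGraph.Walk.mem_support_iff_exists_getVert.1 (hall w)
    have hj0 : j ≠ p.length := by rintro rfl; simp at hw
    exact mem_image.2 ⟨j, by simpa [T, I, hw] using by omega, rfl⟩
  have hR : R.card ≤ F.card := by
    refine card_le_card_of_injOn (fun i => s(p.getVert i, p.getVert (i + 1))) ?_ ?_
    · intro i hi
      exact (mem_filter.1 hi).2
    · intro i hi j hj hij
      have hi' : i < p.length := by simpa [I] using (mem_filter.1 hi).1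
      have hj' : j < p.length := by simpa [I] using (mem_filter.1 hj).1
      have inj := hp.getVert_injOn
      rcases Sym2.eq_iff.1 hij with h | h
      · exact inj (by simp; omega) (by simp; omega) h.1
      · have h1 := inj (by simp; omega) (by simp; omega) h.1
        have h2 := inj (by simp; omega) (by simp; omega) h.2
        omega
  have hST : (S ∪ T).card ≤ p.length := by
    rw [← card_range p.length]
    exact card_le_card (union_subset (filter_subset _ _) (filter_subset _ _))
  have hc := card_union_add_card_inter S T
  obtain ⟨i, hi, hiR⟩ := exists_mem_notMem_of_card_lt_card (s := R) (t := S ∩ T) (by omega)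
  simp only [S, T, I, mem_inter, mem_filter, mem_range] at hi
  obtain ⟨x, y, h, q, r, hqr, hx, hy⟩ := walk_split p i hi.1.1
  rw [← hx, ← hy] at hi
  have hxy : s(x, y) ∉ F := by
    intro hh
    exact hiR (by simpa [R, I, hi.1.1, hx, hy] using hh)
  -- The edge xy is exchanged for vx and uy: the cycle runs y … v, x … u, and back to y.
  refine ⟨y, u, r.append (.cons hi.2.2 q.reverse), ?_, ?_, hi.1.2, ?_⟩
  · rw [SimpleGraph.Walk.isPath_def, support_append_cons, SimpleGraph.Walk.support_reverse]
    have := (SimpleGraph.Walk.isPath_def _).1 hp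
    rw [hqr, support_append_cons] at this
    exact ((List.Perm.append_left _ (List.reverse_perm _)).trans
      List.perm_append_comm).nodup_iff.2 this
  · intro w
    have := hall w
    rw [hqr, support_append_cons] at this
    rw [support_append_cons]
    simpa [or_comm] using this
  · intro e he
    have h1 := hF e he
    rw [hqr] at h1
    simp only [SimpleGraph.Walk.edges_append, SimpleGraph.Walk.edges_cons, List.mem_append,
      List.mem_cons, SimpleGraph.Walk.edges_reverse, List.mem_reverse] at h1 ⊢
    have : e ≠ s(x, y) := by rintro rfl; exact hxy he
    tauto

/-- A form of the Bondy–Chvátal closure theorem for Hamiltonian cycles through given edges. -/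
theorem hamThrough_of_closure [Fintype V] {F : Finset (Sym2 V)} (hV : 3 ≤ Fintype.card V)
    (htop : HamThrough (⊤ : SimpleGraph V) F) (G : SimpleGraph V)
    (hF : ∀ e ∈ F, e ∈ G.edgeSet)
    (hcl : ∀ G' : SimpleGraph V, G ≤ G' → G' ≠ ⊤ → ∃ u v, u ≠ v ∧ ¬ G'.Adj u v ∧
      Fintype.card V + F.card ≤ degOn G' univ u + degOn G' univ v) : HamThrough G F := by
  induction G using WellFoundedGT.induction with
  | ind G ih =>
  by_cases hG : G = ⊤
  · exact hG ▸ htop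
  obtain ⟨u, v, huv, hadj, hdeg⟩ := hcl G le_rfl hG
  have hlt : G < G ⊔ SimpleGraph.edge u v := SimpleGraph.lt_sup_edge _ _ _ huv hadj
  have := ih _ hlt (fun e he => SimpleGraph.edgeSet_mono hlt.le (hF e he))
    (fun G' h => hcl G' (hlt.le.trans h))
  rcases hamThrough_or_path_of_sup_edge hV this with h | ⟨p, hp, hall, hpF⟩
  · exact h
  · refine hamThrough_of_path p hp hall (fun e he => (hpF e he).resolve_left ?_) hdeg
    rintro rfl
    exact hadj (hF _ he)

theorem exists_path_top (q : V) (S : Finset V) (hq : q ∉ S) : ∀ a, a ∉ S → a ≠ q →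
    ∃ p : (⊤ : SimpleGraph V).Walk a q, p.IsPath ∧ ∀ w, w ∈ p.support ↔ w = a ∨ w = q ∨ w ∈ S := by
  classical
  induction S using Finset.induction_on with
  | empty =>
    intro a _ ha
    exact ⟨.cons (by simpa using ha) .nil, by simpa using ha, by simp⟩
  | insert s S hs ih =>
    intro a ha haq
    simp only [mem_insert, not_or] at ha hq
    obtain ⟨p, hp, hps⟩ := ih hq.2 s hs (Ne.symm hq.1)
    refine ⟨.cons (show (⊤ : SimpleGraph V).Adj a s by simpa using ha.1) p, ?_, ?_⟩
    · rw [SimpleGraph.Walk.cons_isPath_iff, hps]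
      tauto
    · intro w
      rw [SimpleGraph.Walk.support_cons, List.mem_cons, hps, mem_insert]
      tauto

theorem hamThrough_top [Fintype V] {a b : V} (hab : a ≠ b) {F : Finset (Sym2 V)}
    (hF : ∀ e ∈ F, e = s(a, b)) : HamThrough (⊤ : SimpleGraph V) F := by
  classical
  obtain ⟨p, hp, hps⟩ := exists_path_top b (univ \ {a, b}) (by simp) a (by simp) hab
  exact ⟨a, b, p, hp, fun w => (hps w).2 (by simp; tauto), by simpa using hab.symm,
    fun e he => Or.inl (hF e he)⟩

theorem exists_not_adj_of_ne_top {G : SimpleGraph V} (h : G ≠ ⊤) :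
    ∃ u v, u ≠ v ∧ ¬ G.Adj u v := by
  by_contra! hc
  exact h (SimpleGraph.ext (by ext u v; exact ⟨fun h => h.ne, fun h => hc u v h⟩))

theorem degOn_mono {G G' : SimpleGraph V} (h : G ≤ G') {S S' : Finset V} (hS : S ⊆ S') (v : V) :
    degOn G S v ≤ degOn G' S' v := by
  classical
  refine card_le_card fun w hw => ?_
  simp only [mem_filter] at hw ⊢
  exact ⟨hS hw.1, h hw.2⟩

/-- Dirac's theorem. -/
theorem hamThrough_of_dirac [Fintype V] (G : SimpleGraph V) (hV : 3 ≤ Fintype.card V)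
    (hdeg : ∀ v, Fintype.card V ≤ 2 * degOn G univ v) : HamThrough G ∅ := by
  obtain ⟨a, b, hab⟩ := Fintype.exists_pair_of_one_lt_card (by omega : 1 < Fintype.card V)
  refine hamThrough_of_closure hV (hamThrough_top hab (by simp)) G (by simp) fun G' hG' hne => ?_
  obtain ⟨u, v, huv, hadj⟩ := exists_not_adj_of_ne_top hne
  have h1 := (hdeg u).trans (Nat.mul_le_mul_left 2 (degOn_mono hG' subset_rfl u))
  have h2 := (hdeg v).trans (Nat.mul_le_mul_left 2 (degOn_mono hG' subset_rfl v))
  exact ⟨u, v, huv, hadj, by simp; omega⟩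

theorem card_le_degOn_add_one [Fintype V] {G : SimpleGraph V} {A : Finset V} {a : V}
    (h : ∀ b ∈ A, a ≠ b → G.Adj a b) : A.card ≤ degOn G univ a + 1 := by
  classical
  refine (card_le_card (t := insert a (univ.filter (G.Adj a))) fun b hb => ?_).trans
    (card_insert_le _ _)
  by_cases hab : a = b
  · simp [hab]
  · simp [h b hb hab]

/-- Hamiltonian-connectedness of a graph in which a set `A` of vertices of large degree contains
all but few vertices. -/
theorem exists_ham_path [Fintype V] (G : SimpleGraph V) (A : Finset V) (d s : ℕ)
    (hA : ∀ a ∈ A, Fintype.card V + 1 ≤ 2 * degOn G univ a)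
    (hAc : ∀ v ∉ A, d ≤ degOn G univ v)
    (hs : Fintype.card V ≤ A.card + s) (hds : s + 2 ≤ d) (hAs : s + 3 ≤ A.card)
    {a b : V} (hab : a ≠ b) :
    ∃ p : G.Walk a b, p.IsPath ∧ ∀ w, w ∈ p.support := by
  have hV : 3 ≤ Fintype.card V := by have := card_le_univ A; omega
  -- A Hamiltonian path from a to b is a Hamiltonian cycle of G + ab through ab, so the closure
  -- threshold is n + 1.
  have main : HamThrough (G ⊔ SimpleGraph.edge a b) {s(a, b)} := by
    refine hamThrough_of_closure hV (hamThrough_top hab (by simp)) _ ?_ fun G' hG' hne => ?_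
    · simp [hab]
    have hGG' : G ≤ G' := le_sup_left.trans hG'
    have mono := fun v => degOn_mono hGG' (subset_refl univ) v
    rw [card_singleton]
    -- In a closed G' the pairs fill up in three rounds: inside A, since both degrees are at least
    -- (n + 1)/2; between A and its complement, since |A| - 1 + d ≥ n + 1; and outside A, where all
    -- degrees are now at least |A|.
    by_contra! hc
    have h1 : ∀ u ∈ A, ∀ v ∈ A, u ≠ v → G'.Adj u v := by
      intro u hu v hv huv
      by_contra hn
      have := hc u v huv hn
      have := hA u hu
      have := hA v hv
      have := mono u
      have := mono v
      omega
    have h2 : ∀ u ∈ A, ∀ v ∉ A, G'.Adj u v := by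
      intro u hu v hv
      by_contra hn
      have := hc u v (by rintro rfl; exact hv hu) hn
      have := card_le_degOn_add_one (h1 u hu)
      have := hAc v hv
      have := mono v
      omega
    have h3 : ∀ v ∉ A, A.card ≤ degOn G' univ v := by
      intro v hv
      refine card_le_card fun u hu => ?_
      simpa using (h2 u hu v hv).symm
    obtain ⟨u, v, huv, hn⟩ := exists_not_adj_of_ne_top hne
    by_cases hu : u ∈ A
    · by_cases hv : v ∈ A
      · exact hn (h1 u hu v hv huv)
      · exact hn (h2 u hu v hv)
    · by_cases hv : v ∈ A
      · exact hn (h2 v hv u hu).symm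
      · have := hc u v huv hn
        have := h3 u hu
        have := h3 v hv
        omega
  -- With ab first removed from G, a cycle through ab inside the smaller graph is impossible, so
  -- only the path alternative remains.
  rw [← sdiff_sup_self] at main
  have hadj : ¬ (G \ SimpleGraph.edge a b).Adj a b := by simp [SimpleGraph.edge_adj, hab]
  rcases hamThrough_or_path_of_sup_edge hV main with ⟨x, y, p, hp, hall, hxy, hF⟩ | ⟨p, hp, hall, -⟩
  · exfalso
    rcases hF _ (mem_singleton_self _) with h | h
    · rcases Sym2.eq_iff.1 h with ⟨rfl, rfl⟩ | ⟨rfl, rfl⟩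
      · exact hadj hxy.symm
      · exact hadj hxy
    · exact hadj (p.edges_subset_edgeSet h)
  · exact ⟨p.mapLe sdiff_le, hp.mapLe _, by simpa using hall⟩

end Hamiltonian

/-! ### König's theorem. -/

section Matching

/-- The hard direction of König's theorem: if every vertex cover of a finite bipartite graph has at
least `m` elements then there is a matching with `m` edges. -/
theorem exists_matching_of_cover {α β : Type*} [Fintype α] [Fintype β] (r : α → β → Prop) (m : ℕ)
    (h : ∀ (C : Finset α) (D : Finset β), (∀ x y, r x y → x ∈ C ∨ y ∈ D) → m ≤ C.card + D.card) :
    ∃ (f : Fin m → α) (g : Fin m → β), f.Injective ∧ g.Injective ∧ ∀ i, r (f i) (g i) := by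
  classical
  let cov := univ.filter fun p : Finset α × Finset β => ∀ x y, r x y → x ∈ p.1 ∨ y ∈ p.2
  obtain ⟨⟨C, D⟩, hCD, hmin⟩ := exists_min_image cov (fun p => p.1.card + p.2.card)
    ⟨(univ, univ), by simp [cov]⟩
  simp only [cov, mem_filter, mem_univ, true_and, Prod.forall] at hCD hmin
  -- Hall's condition holds from C to the complement of D: replacing a violating S ⊆ C by its
  -- neighbours outside D would give a smaller cover. The same argument matches D outside C.
  obtain ⟨f, hf, hfm⟩ := (all_card_le_biUnion_card_iff_exists_injective
    (fun c : C => univ.filter (r c.1) \ D)).1 (fun S => by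
      set N := S.biUnion fun c : C => univ.filter (r c.1) \ D
      have := hmin (C \ S.map (Function.Embedding.subtype _)) (D ∪ N) (fun x y hxy => by
        by_cases hx : x ∈ C
        · by_cases hxS : ⟨x, hx⟩ ∈ S
          · right
            by_cases hy : y ∈ D
            · exact mem_union_left _ hy
            · exact mem_union_right _ (mem_biUnion.2 ⟨⟨x, hx⟩, hxS, by simp [hxy, hy]⟩)
          · left
            simp [hx, hxS]
        · exact Or.inr (mem_union_left _ ((hCD x y hxy).resolve_left hx)))
      have hsub : S.map (Function.Embedding.subtype _) ⊆ C := fun x hx => by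
        obtain ⟨y, -, rfl⟩ := mem_map.1 hx
        exact y.2
      rw [card_sdiff_of_subset hsub, card_map] at this
      have h1 := card_le_card hsub
      rw [card_map] at h1
      have := card_union_le D N
      omega)
  obtain ⟨g, hg, hgm⟩ := (all_card_le_biUnion_card_iff_exists_injective
    (fun d : D => univ.filter (fun x => r x d.1) \ C)).1 (fun S => by
      set N := S.biUnion fun d : D => univ.filter (fun x => r x d.1) \ C
      have := hmin (C ∪ N) (D \ S.map (Function.Embedding.subtype _)) (fun x y hxy => by
        by_cases hy : y ∈ D
        · by_cases hyS : ⟨y, hy⟩ ∈ S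
          · left
            by_cases hx : x ∈ C
            · exact mem_union_left _ hx
            · exact mem_union_right _ (mem_biUnion.2 ⟨⟨y, hy⟩, hyS, by simp [hxy, hx]⟩)
          · right
            simp [hy, hyS]
        · exact Or.inl (mem_union_left _ ((hCD x y hxy).resolve_right hy)))
      have hsub : S.map (Function.Embedding.subtype _) ⊆ D := fun x hx => by
        obtain ⟨y, -, rfl⟩ := mem_map.1 hx
        exact y.2
      rw [card_sdiff_of_subset hsub, card_map] at this
      have h1 := card_le_card hsub
      rw [card_map] at h1
      have := card_union_le C N
      omega)
  simp only [mem_sdiff, mem_filter, mem_univ, true_and] at hfm hgm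
  have hcard : Fintype.card (Fin m) ≤ Fintype.card (C ⊕ D) := by
    simpa using h C D hCD
  obtain ⟨e⟩ := Function.Embedding.nonempty_of_card_le hcard
  -- The two matchings are disjoint because `f` takes values outside D and `g` outside C, so
  -- together they have |C| + |D| ≥ m edges.
  refine ⟨fun i => Sum.elim (fun c => c.1) g (e i), fun i => Sum.elim f (fun d => d.1) (e i),
    ?_, ?_, ?_⟩
  · refine Function.Injective.comp (g := Sum.elim (fun c : C => c.1) g) ?_ e.injective
    refine Function.Injective.sumElim Subtype.val_injective hg fun c d hcd => ?_
    exact (hgm d).2 (hcd ▸ c.2)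
  · refine Function.Injective.comp (g := Sum.elim f (fun d : D => d.1)) ?_ e.injective
    refine Function.Injective.sumElim hf Subtype.val_injective fun c d hcd => ?_
    exact (hfm c).2 (hcd ▸ d.2)
  · intro i
    change r (Sum.elim (fun c : C => c.1) g (e i)) (Sum.elim f (fun d : D => d.1) (e i))
    rcases e i with c | d
    · exact (hfm c).1
    · exact (hgm d).1

end Matching

/-! ### Connectivity in terms of vertex tripartitions. -/

section Separation

variable {V : Type*}

/-- `A`, `T`, `B` partition the vertex set, with `A` and `B` nonempty. -/
structure IsTripartition (A T B : Finset V) : Prop where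
  left_nonempty : A.Nonempty
  right_nonempty : B.Nonempty
  left_sep : Disjoint A T
  right_sep : Disjoint B T
  left_right : Disjoint A B
  cover : ∀ v, v ∈ A ∨ v ∈ T ∨ v ∈ B

theorem IsTripartition.symm {A T B : Finset V} (h : IsTripartition A T B) : IsTripartition B T A :=
  ⟨h.2, h.1, h.4, h.3, h.5.symm, fun v => by have := h.6 v; tauto⟩

variable [Fintype V]

theorem IsTripartition.card_eq {A T B : Finset V} (h : IsTripartition A T B) :
    A.card + T.card + B.card = Fintype.card V := by
  classical
  rw [← card_union_of_disjoint h.left_sep, ← card_union_of_disjoint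
    (disjoint_union_left.2 ⟨h.left_right, h.right_sep.symm⟩), ← card_univ]
  congr 1
  ext v
  simpa [or_assoc] using h.cover v

theorem IsKConnected.le_card {G : SimpleGraph V} {k : ℕ} (hG : IsKConnected k G)
    {A T B : Finset V} (h : IsTripartition A T B) (hAB : ∀ a ∈ A, ∀ b ∈ B, ¬ G.Adj a b) :
    k ≤ T.card := by
  refine le_trans hG (Nat.sInf_le ⟨T, ?_, rfl, Or.inl fun hc => ?_⟩)
  · rintro rfl
    obtain ⟨a, ha⟩ := h.left_nonempty
    exact disjoint_left.1 h.left_sep ha (mem_univ a)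
  · obtain ⟨a, ha⟩ := h.left_nonempty
    obtain ⟨b, hb⟩ := h.right_nonempty
    have haT : a ∉ T := disjoint_left.1 h.left_sep ha
    have hbT : b ∉ T := disjoint_left.1 h.right_sep hb
    obtain ⟨p⟩ := hc.preconnected ⟨a, haT⟩ ⟨b, hbT⟩
    have key : ∀ (x y : {v : V | v ∉ T}), (G.induce {v : V | v ∉ T}).Walk x y →
        x.1 ∈ A → y.1 ∈ A := by
      intro x y p
      induction p with
      | nil => exact id
      | @cons x z y hxz _ ih =>
        intro hx
        refine ih ?_
        rcases h.cover z.1 with hz | hz | hz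
        · exact hz
        · exact absurd hz z.2
        · exact absurd hxz (hAB _ hx _ hz)
    exact disjoint_left.1 h.left_right (key _ _ p ha) hb

theorem isKConnected_of_forall {G : SimpleGraph V} {k : ℕ} (hk : k + 1 ≤ Fintype.card V)
    (h : ∀ A T B : Finset V, IsTripartition A T B → (∀ a ∈ A, ∀ b ∈ B, ¬ G.Adj a b) →
      k ≤ T.card) : IsKConnected k G := by
  classical
  have : Nonempty V := Fintype.card_pos_iff.1 (by omega)
  obtain ⟨v⟩ := this
  -- `sInf` of the empty set is 0, so a member is needed: deleting all vertices but one.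
  refine le_csInf ⟨_, univ.erase v, ?_, rfl, Or.inr ?_⟩ ?_
  · intro h
    exact notMem_erase v univ (by rw [h]; exact mem_univ v)
  · rw [card_erase_of_mem (mem_univ v), card_univ]
    omega
  rintro _ ⟨T, hT, rfl, hc | hc⟩
  · have hne : Nonempty {v : V | v ∉ T} := by
      by_contra hn
      refine hT (eq_univ_iff_forall.2 fun v => ?_)
      by_contra hv
      exact hn ⟨⟨v, hv⟩⟩
    have hpre : ¬ (G.induce {v : V | v ∉ T}).Preconnected := fun hp => hc ⟨hp⟩
    unfold SimpleGraph.Preconnected at hpre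
    push Not at hpre
    obtain ⟨⟨a, ha⟩, ⟨b, hb⟩, hab⟩ := hpre
    have ha : a ∉ T := ha
    have hb : b ∉ T := hb
    set R : V → Prop := fun v => ∃ hv : v ∉ T,
      (G.induce {v : V | v ∉ T}).Reachable ⟨a, ha⟩ ⟨v, hv⟩
    refine h (univ.filter R) T (univ.filter fun v => v ∉ T ∧ ¬ R v) ⟨⟨a, ?_⟩, ⟨b, ?_⟩, ?_, ?_, ?_, ?_⟩ ?_
    · simpa using ⟨ha, .refl _⟩
    · simp only [mem_filter, mem_univ, true_and]
      exact ⟨hb, fun ⟨_, hr⟩ => hab hr⟩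
    · exact disjoint_left.2 fun v hv => (mem_filter.1 hv).2.1
    · exact disjoint_left.2 fun v hv => (mem_filter.1 hv).2.1
    · exact disjoint_left.2 fun v hv hv' => (mem_filter.1 hv').2.2 (mem_filter.1 hv).2
    · intro v
      simp only [mem_filter, mem_univ, true_and]
      tauto
    · intro x hx y hy hxy
      simp only [mem_filter, mem_univ, true_and] at hx hy
      obtain ⟨hxT, hr⟩ := hx
      refine hy.2 ⟨hy.1, hr.trans (SimpleGraph.Adj.reachable ?_)⟩
      exact hxy
  · omega

end Separation

/-! ### Paths in induced subgraphs and degrees along a Hamiltonian cycle. -/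

section Cycles

variable {V : Type*}

theorem degOn_univ_induce {G : SimpleGraph V} {A P : Finset V} (hAP : A ⊆ P) (v : P) :
    degOn G A v ≤ degOn (G.induce (P : Set V)) univ v := by
  classical
  rw [degOn, degOn, ← card_map (Function.Embedding.subtype _)]
  refine card_le_card fun w hw => ?_
  rw [mem_filter] at hw
  exact mem_map.2 ⟨⟨w, hAP hw.1⟩, by simpa using hw.2, rfl⟩

/-- A version of `exists_ham_path` for the subgraph induced on `P`. -/
theorem exists_ham_path_on (G : SimpleGraph V) {A P : Finset V} (hAP : A ⊆ P) (d s : ℕ)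
    (hA : ∀ a ∈ A, P.card + 1 ≤ 2 * degOn G A a)
    (hAc : ∀ v ∈ P, v ∉ A → d ≤ degOn G A v)
    (hs : P.card ≤ A.card + s) (hds : s + 2 ≤ d) (hAs : s + 3 ≤ A.card)
    {a b : V} (ha : a ∈ P) (hb : b ∈ P) (hab : a ≠ b) :
    ∃ p : G.Walk a b, p.IsPath ∧ ∀ w, w ∈ p.support ↔ w ∈ P := by
  classical
  have hcard : Fintype.card (P : Set V) = P.card := by simp
  have hA' : (A.subtype (· ∈ (P : Set V))).card = A.card := by
    rw [card_subtype, filter_true_of_mem]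
    exact fun x hx => hAP hx
  obtain ⟨p, hp, hall⟩ := exists_ham_path (G.induce (P : Set V)) (A.subtype (· ∈ (P : Set V))) d s
    (fun v hv => by
      rw [hcard]
      exact (hA v (mem_subtype.1 hv)).trans (Nat.mul_le_mul_left 2 (degOn_univ_induce hAP v)))
    (fun v hv => (hAc v v.2 (fun h => hv (mem_subtype.2 h))).trans (degOn_univ_induce hAP v))
    (by rwa [hcard, hA']) hds (by rwa [hA']) (a := ⟨a, ha⟩) (b := ⟨b, hb⟩) (by simpa using hab)
  have hsupp : ∀ w, w ∈ (p.map (SimpleGraph.Embedding.induce _).toHom).support ↔ w ∈ P := by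
    intro w
    rw [SimpleGraph.Walk.support_map, List.mem_map]
    constructor
    · rintro ⟨x, -, rfl⟩
      exact x.2
    · intro hw
      exact ⟨⟨w, hw⟩, hall _, rfl⟩
  exact ⟨p.map (SimpleGraph.Embedding.induce _).toHom, hp.map Subtype.val_injective, hsupp⟩

variable [Fintype V]

theorem isHamiltonianCycle_cons [DecidableEq V] {G : SimpleGraph V} (hV : 3 ≤ Fintype.card V)
    {a b : V} {p : G.Walk a b} (hp : p.IsPath) (hall : ∀ w, w ∈ p.support) (hba : G.Adj b a) :
    (SimpleGraph.Walk.cons hba p).IsHamiltonianCycle := by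
  rw [SimpleGraph.Walk.isHamiltonianCycle_iff_isCycle_and_length_eq,
    SimpleGraph.Walk.cons_isCycle_iff]
  refine ⟨⟨hp, fun h => ?_⟩, length_add_one_eq_card hp hall⟩
  rw [Sym2.eq_swap] at h
  have := card_le_two_of_edge_mem hp hall h
  omega

/-- All G-edges from a to B must lie on H, which has exactly two edges at a. Hence separations of G
- E(H) are thin in G. -/
theorem degOn_le_two_of_deleteEdges [DecidableEq V] {G : SimpleGraph V} {v : V} {H : G.Walk v v}
    (hH : H.IsHamiltonianCycle) {a : V} {B : Finset V}
    (h : ∀ b ∈ B, ¬ (G.deleteEdges H.edgeSet).Adj a b) : degOn G B a ≤ 2 := by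
  classical
  have h2 := hH.isCycle.ncard_neighborSet_toSubgraph_eq_two (hH.mem_support a)
  rw [degOn, ← h2, ← Set.ncard_coe_finset]
  refine Set.ncard_le_ncard (fun b hb => ?_) (Set.toFinite _)
  simp only [coe_filter, Set.mem_ofPred_eq] at hb
  have := h b hb.1
  rw [SimpleGraph.deleteEdges_adj] at this
  have : s(a, b) ∈ H.edgeSet := by tauto
  simpa [SimpleGraph.Walk.adj_toSubgraph_iff_mem_edges] using this

end Cycles

/-! ### Elementary bounds for degrees into a set. -/

section Degrees

variable {V : Type*} {G : SimpleGraph V}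

theorem degOn_le_card (S : Finset V) (v : V) : degOn G S v ≤ S.card := by
  classical exact card_filter_le _ _

theorem degOn_lt_card {S : Finset V} {v : V} (hv : v ∈ S) : degOn G S v < S.card := by
  classical exact card_lt_card (filter_ssubset.2 ⟨v, hv, G.irrefl⟩)

theorem degOn_le_add [DecidableEq V] {S S₁ S₂ : Finset V} (h : S ⊆ S₁ ∪ S₂) (v : V) :
    degOn G S v ≤ degOn G S₁ v + degOn G S₂ v := by
  refine (degOn_mono le_rfl h v).trans ?_
  rw [degOn, filter_union]
  exact card_union_le _ _

theorem exists_adj_of_degOn_pos {S : Finset V} {v : V} (h : 0 < degOn G S v) :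
    ∃ w ∈ S, G.Adj v w := by
  classical
  obtain ⟨w, hw⟩ := card_pos.1 h
  exact ⟨w, (mem_filter.1 hw).1, (mem_filter.1 hw).2⟩

theorem exists_adj_ne_of_one_lt_degOn {S : Finset V} {v : V} (h : 1 < degOn G S v) (q : V) :
    ∃ w ∈ S, w ≠ q ∧ G.Adj v w := by
  classical
  obtain ⟨w, hw, hne⟩ := exists_mem_ne h q
  exact ⟨w, (mem_filter.1 hw).1, hne, (mem_filter.1 hw).2⟩

end Degrees

/-! ### Thin tripartitions and their essential uniqueness. -/

section Thin

variable {V : Type*} {G : SimpleGraph V} {k : ℕ}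

/-- A tripartition which becomes a separation by fewer than `k` vertices after the deletion of
a subgraph of maximum degree at most two satisfies these conditions. -/
structure IsThin (G : SimpleGraph V) (k : ℕ) (A T B : Finset V) : Prop
    extends IsTripartition A T B where
  card_lt : T.card < k
  left_le : ∀ a ∈ A, degOn G B a ≤ 2
  right_le : ∀ b ∈ B, degOn G A b ≤ 2

theorem IsThin.symm {A T B : Finset V} (h : IsThin G k A T B) : IsThin G k B T A :=
  ⟨h.1.symm, h.2, h.4, h.3⟩

variable [Fintype V]

theorem IsTripartition.degOn_univ_le {A T B : Finset V} (h : IsTripartition A T B) (v : V) :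
    degOn G univ v ≤ degOn G A v + degOn G T v + degOn G B v := by
  classical
  have h1 := degOn_le_add (G := G) (S := univ) (S₁ := A ∪ T) (S₂ := B)
    (fun v _ => by have := h.cover v; simp; tauto) v
  have h2 := degOn_le_add (G := G) (subset_refl (A ∪ T)) v
  omega

variable (hdeg : ∀ v, Fintype.card V ≤ 2 * degOn G univ v)

include hdeg

/-- Of the at least n/2 neighbours of a, at most two lie in B and at most |T| in T. -/
theorem IsThin.le_degOn {A T B : Finset V} (h : IsThin G k A T B) {a : V} (ha : a ∈ A) :
    Fintype.card V ≤ 2 * degOn G A a + 2 * T.card + 4 := by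
  have := hdeg a
  have := h.degOn_univ_le (G := G) a
  have := h.left_le a ha
  have := degOn_le_card (G := G) T a
  omega

theorem IsThin.le_card_left {A T B : Finset V} (h : IsThin G k A T B) :
    Fintype.card V ≤ 2 * A.card + 2 * T.card + 2 := by
  obtain ⟨a, ha⟩ := h.left_nonempty
  have := h.le_degOn hdeg ha
  have := degOn_lt_card (G := G) ha
  omega

variable (hn : 6 * k + 10 ≤ Fintype.card V)

include hn

/-- A is too dense to be cut. For x in A ∩ A' and y in A ∩ B', the neighbourhoods within A overlap
in little more than T', so their degrees into A sum to at most |A| + |T'| + 2. As |A| ≤ n/2 + 1,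
this forces n ≤ 6k + 8. -/
theorem IsThin.disjoint_or {A T B A' T' B' : Finset V} (h : IsThin G k A T B)
    (h' : IsThin G k A' T' B') : Disjoint A A' ∨ Disjoint A B' := by
  classical
  by_contra! hc
  obtain ⟨⟨x, hxA, hxA'⟩, ⟨y, hyA, hyB'⟩⟩ := hc.imp not_disjoint_iff.1 not_disjoint_iff.1
  have hx1 := h.le_degOn hdeg hxA
  have hy1 := h.le_degOn hdeg hyA
  have hx2 := degOn_le_add (G := G) (S := A) (S₁ := A \ B') (S₂ := B') (by simp) x
  have hy2 := degOn_le_add (G := G) (S := A) (S₁ := A \ A') (S₂ := A') (by simp) y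
  have hx3 := h'.left_le x hxA'
  have hy3 := h'.right_le y hyB'
  have hx4 := degOn_lt_card (G := G)
    (mem_sdiff.2 ⟨hxA, disjoint_left.1 h'.left_right hxA'⟩ : x ∈ A \ B')
  have hy4 := degOn_lt_card (G := G)
    (mem_sdiff.2 ⟨hyA, disjoint_right.1 h'.left_right hyB'⟩ : y ∈ A \ A')
  have h1 : (A \ B').card + (A \ A').card ≤ A.card + T'.card := by
    rw [← card_union_add_card_inter]
    refine Nat.add_le_add (card_le_card (union_subset sdiff_subset sdiff_subset))
      (card_le_card fun v hv => ?_)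
    have := h'.cover v
    simp only [mem_inter, mem_sdiff] at hv
    tauto
  have h2 := h.symm.le_card_left hdeg
  have h3 := h.card_eq
  have := h.card_lt
  have := h'.card_lt
  omega

/-- Otherwise A' ⊆ T would have fewer than k vertices, whereas a side of a thin tripartition has
nearly n/2. -/
theorem IsThin.not_disjoint {A T B A' T' B' : Finset V} (h : IsThin G k A T B)
    (h' : IsThin G k A' T' B') (hA : Disjoint A A') (hB : Disjoint B A') : False := by
  have h1 : A'.card ≤ T.card := card_le_card fun v hv =>
    ((h.cover v).resolve_left (disjoint_right.1 hA hv)).resolve_right (disjoint_right.1 hB hv)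
  have := h'.le_card_left hdeg
  have := h.card_lt
  have := h'.card_lt
  omega

theorem IsThin.compare {A T B A' T' B' : Finset V} (h : IsThin G k A T B)
    (h' : IsThin G k A' T' B') :
    (Disjoint A B' ∧ Disjoint B A') ∨ (Disjoint A A' ∧ Disjoint B B') := by
  have h1 := h.disjoint_or hdeg hn h'
  have h2 := h.symm.disjoint_or hdeg hn h'
  have h3 := h.not_disjoint hdeg hn h'
  have h4 := h.not_disjoint hdeg hn h'.symm
  tauto

end Thin

/-! ### Construction of the cycle in the presence of a thin tripartition. -/

section Main

variable {V : Type*} [Fintype V] {G : SimpleGraph V} {k : ℕ}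

/-- The vertices with at most `k + 1` neighbours in `B`. -/
noncomputable def sparseTo (G : SimpleGraph V) (k : ℕ) (B : Finset V) : Finset V :=
  univ.filter fun v => degOn G B v ≤ k + 1

theorem mem_sparseTo {B : Finset V} {v : V} : v ∈ sparseTo G k B ↔ degOn G B v ≤ k + 1 := by
  simp [sparseTo]

theorem IsThin.left_subset {A T B : Finset V} (h : IsThin G k A T B) : A ⊆ sparseTo G k B :=
  fun a ha => mem_sparseTo.2 (by have := h.left_le a ha; have := h.card_lt; omega)

/-- This explains the threshold k + 1 of `sparseTo`: since B ⊆ B' ∪ T', a vertex of A' has at most 2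
+ (k - 1) neighbours in B. -/
theorem IsThin.subset_of_disjoint {B A' T' B' : Finset V}
    (h' : IsThin G k A' T' B') (hBA : Disjoint B A') : A' ⊆ sparseTo G k B := by
  classical
  intro a ha
  have h1 := h'.left_le a ha
  have h2 := degOn_le_add (G := G) (S := B) (S₁ := B') (S₂ := T') (fun v hv => by
    have := h'.cover v
    have := disjoint_left.1 hBA hv
    simp only [mem_union]
    tauto) a
  have := degOn_le_card (G := G) T' a
  have := h'.card_lt
  rw [mem_sparseTo]
  omega

/-- Two Hamiltonian paths of complementary vertex sets, joined to a Hamiltonian cycle by two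
disjoint edges. -/
theorem exists_hamiltonianCycle_of_paths [DecidableEq V] {P : Finset V} {p₁ p₂ q₁ q₂ : V}
    (hV : 3 ≤ Fintype.card V) {p : G.Walk p₁ p₂} {q : G.Walk q₂ q₁} (hp : p.IsPath)
    (hq : q.IsPath) (hpP : ∀ w, w ∈ p.support ↔ w ∈ P) (hqP : ∀ w, w ∈ q.support ↔ w ∉ P)
    (h₁ : G.Adj p₁ q₁) (h₂ : G.Adj p₂ q₂) :
    ∃ (v : V) (H : G.Walk v v), H.IsHamiltonianCycle ∧
      ∀ x ∈ P, ∀ y ∉ P, s(x, y) ∈ H.edgeSet → x = p₁ ∨ x = p₂ := by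
  have hpath : (p.append (.cons h₂ q)).IsPath := by
    rw [SimpleGraph.Walk.isPath_def, support_append_cons, List.nodup_append]
    refine ⟨hp.support_nodup, hq.support_nodup, ?_⟩
    rintro a ha _ hb rfl
    exact (hqP a).1 hb ((hpP a).1 ha)
  refine ⟨_, _, isHamiltonianCycle_cons hV hpath (fun w => ?_) h₁.symm, ?_⟩
  · rw [support_append_cons, List.mem_append, hpP, hqP]
    exact em _
  · intro x hx y hy hxy
    have hp₁ := (hpP p₁).1 p.start_mem_support
    have hp₂ := (hpP p₂).1 p.end_mem_support
    have hq₁ := (hqP q₁).1 q.end_mem_support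
    rw [SimpleGraph.Walk.mem_edgeSet, SimpleGraph.Walk.edges_cons, SimpleGraph.Walk.edges_append,
      SimpleGraph.Walk.edges_cons, List.mem_cons, List.mem_append, List.mem_cons] at hxy
    rcases hxy with h | h | h | h
    · rcases Sym2.eq_iff.1 h with ⟨rfl, rfl⟩ | ⟨rfl, rfl⟩
      · exact absurd hx hq₁
      · exact Or.inl rfl
    · exact absurd ((hpP y).1 (p.snd_mem_support_of_mem_edges h)) hy
    · rcases Sym2.eq_iff.1 h with ⟨rfl, rfl⟩ | ⟨rfl, rfl⟩
      · exact Or.inr rfl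
      · exact absurd hp₂ hy
    · exact absurd hx ((hqP x).1 (q.fst_mem_support_of_mem_edges h))

variable (hdeg : ∀ v, Fintype.card V ≤ 2 * degOn G univ v)
variable (hn : 6 * k + 10 ≤ Fintype.card V)

include hdeg hn

/-- A vertex sparse to both sides would have degree at most 2(k + 1) + (k - 1) < n/2. -/
theorem IsThin.disjoint_sparseTo {A T B : Finset V} (h : IsThin G k A T B) :
    Disjoint (sparseTo G k B) (sparseTo G k A) := by
  refine disjoint_left.2 fun v hv hv' => ?_
  rw [mem_sparseTo] at hv hv'
  have := hdeg v
  have := h.degOn_univ_le (G := G) v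
  have := degOn_le_card (G := G) T v
  have := h.card_lt
  omega

/-- P consists of the dense set A and at most |T| further vertices, each with at least k + 2
neighbours in A because it is not sparse to A. -/
theorem IsThin.exists_ham_path_on {A T B P : Finset V} (h : IsThin G k A T B)
    (hAP : A ⊆ P) (hBP : Disjoint B P) (hP : Disjoint P (sparseTo G k A))
    {a b : V} (ha : a ∈ P) (hb : b ∈ P) (hab : a ≠ b) :
    ∃ p : G.Walk a b, p.IsPath ∧ ∀ w, w ∈ p.support ↔ w ∈ P := by
  classical
  have hPc : P.card ≤ A.card + T.card := by
    refine (card_le_card (t := A ∪ T) fun v hv => ?_).trans (card_union_le _ _)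
    have := h.cover v
    have := disjoint_right.1 hBP hv
    simp only [mem_union]
    tauto
  have h1 := h.card_lt
  have h2 := h.le_card_left hdeg
  have h3 := h.symm.le_card_left hdeg
  have h4 := h.card_eq
  refine DiracConn.exists_ham_path_on G hAP (k + 2) T.card (fun a ha => ?_) (fun v hv _ => ?_) hPc
    (by omega) (by omega) ha hb hab
  · have := h.le_degOn hdeg ha
    omega
  · have := disjoint_left.1 hP hv
    rw [mem_sparseTo] at this
    omega

/-- A cover of the X-Y edges by fewer than k - |Z| vertices would, together with Z, separate the
rest of X from the rest of Y in G by fewer than k vertices. -/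
theorem IsThin.exists_matching [DecidableEq V] {A T B : Finset V} (h : IsThin G k A T B)
    (hG : IsKConnected k G) :
    ∃ f g : Fin (k - (sparseTo G k B ∪ sparseTo G k A)ᶜ.card) → V, f.Injective ∧ g.Injective ∧
      ∀ i, f i ∈ sparseTo G k B ∧ g i ∈ sparseTo G k A ∧ G.Adj (f i) (g i) := by
  refine exists_matching_of_cover
    (fun x y => x ∈ sparseTo G k B ∧ y ∈ sparseTo G k A ∧ G.Adj x y) _ fun C D hCD => ?_
  by_contra! hlt
  have hd := h.disjoint_sparseTo hdeg hn
  have hXA := card_le_card h.left_subset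
  have hYB := card_le_card h.symm.left_subset
  have hA := h.le_card_left hdeg
  have hB := h.symm.le_card_left hdeg
  have hk := h.card_lt
  set X := sparseTo G k B
  set Y := sparseTo G k A
  have hu := card_union_le C D
  have hu' := card_union_le (X ∪ Y)ᶜ (C ∪ D)
  have ne : ∀ S : Finset V, (C ∪ D).card < S.card → (S \ (C ∪ D)).Nonempty := fun S hS => by
    obtain ⟨v, hv, hv'⟩ := exists_mem_notMem_of_card_lt_card hS
    exact ⟨v, mem_sdiff.2 ⟨hv, hv'⟩⟩
  have := hG.le_card (A := X \ (C ∪ D)) (B := Y \ (C ∪ D)) (T := (X ∪ Y)ᶜ ∪ (C ∪ D))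
    ⟨ne X (by omega), ne Y (by omega), ?_, ?_, ?_, ?_⟩ ?_
  · omega
  · refine disjoint_left.2 fun v hv => ?_
    simp at hv ⊢
    tauto
  · refine disjoint_left.2 fun v hv => ?_
    simp at hv ⊢
    tauto
  · exact hd.mono sdiff_subset sdiff_subset
  · intro v
    simp
    tauto
  · intro x hx y hy hxy
    simp only [mem_sdiff, mem_union, not_or] at hx hy
    have := hCD x y ⟨hx.1, hy.1, hxy⟩
    tauto

/-- Vertices of Z have many neighbours in B ⊆ Y and are never matched. If |Z| ≤ 1, then |X| ≤ |Y|
makes X ∪ Z too small to hold all neighbours of a vertex of A, so unmatched vertices of A serve as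
well. -/
theorem IsThin.exists_disjoint_edges [DecidableEq V] {A T B : Finset V} (h : IsThin G k A T B)
    (hXY : (sparseTo G k B).card ≤ (sparseTo G k A).card) {m : ℕ} (hm : m ≤ k) (f : Fin m → V)
    (hf : ∀ i, f i ∈ sparseTo G k B) :
    ∃ p₁ p₂ q₁ q₂ : V, p₁ ∉ sparseTo G k A ∧ p₂ ∉ sparseTo G k A ∧ q₁ ∈ sparseTo G k A ∧
      q₂ ∈ sparseTo G k A ∧ p₁ ≠ p₂ ∧ q₁ ≠ q₂ ∧ G.Adj p₁ q₁ ∧ G.Adj p₂ q₂ ∧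
      ∀ i, f i ≠ p₁ ∧ f i ≠ p₂ := by
  have hd := h.disjoint_sparseTo hdeg hn
  have hAX : A ⊆ sparseTo G k B := h.left_subset
  have hBY : B ⊆ sparseTo G k A := h.symm.left_subset
  have hY : ∀ y ∈ sparseTo G k A, degOn G A y ≤ k + 1 := fun y => mem_sparseTo.1
  have hX : ∀ x ∉ sparseTo G k B, k + 1 < degOn G B x := fun x hx => by
    rw [mem_sparseTo] at hx
    omega
  have hA := h.le_card_left hdeg
  have hk := h.card_lt
  set X := sparseTo G k B
  set Y := sparseTo G k A
  set Z := (X ∪ Y)ᶜ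
  set W := A \ univ.image f
  have hZ : ∀ z ∈ Z, z ∉ X ∧ z ∉ Y := by simp [Z]
  have hZf : ∀ z ∈ Z, ∀ i, f i ≠ z := fun z hz i hi => (hZ z hz).1 (hi ▸ hf i)
  have hWf : ∀ w ∈ W, ∀ i, f i ≠ w := by
    intro w hw i hi
    exact (mem_sdiff.1 hw).2 (mem_image.2 ⟨i, mem_univ i, hi⟩)
  have hWA : W ⊆ A := sdiff_subset
  have hAY : ∀ a ∈ A, a ∉ Y := fun a ha => disjoint_left.1 hd (hAX ha)
  have hW : k + 1 < W.card := by
    have h1 := le_card_sdiff (univ.image f) A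
    have h2 : (univ.image f).card ≤ m := card_image_le.trans (by simp)
    have : A.card - (univ.image f).card ≤ W.card := h1
    omega
  obtain ⟨w, hw⟩ := card_pos.1 (by omega : 0 < W.card)
  have hAadj : Z.card ≤ 1 → ∀ a ∈ A, ∃ y ∈ Y, G.Adj a y := by
    intro hZ1 a ha
    refine exists_adj_of_degOn_pos (Nat.pos_of_ne_zero fun h0 => ?_)
    have h1 := hdeg a
    have h2 := degOn_le_add (G := G) (S := univ) (S₁ := X ∪ Z) (S₂ := Y)
      (fun v _ => by simp [Z]; tauto) a
    have h3 := degOn_le_add (G := G) (subset_refl (X ∪ Z)) a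
    have h4 := degOn_lt_card (G := G) (hAX ha)
    have h5 := degOn_le_card (G := G) Z a
    have h6 : Z.card = Fintype.card V - (X ∪ Y).card := card_compl _
    have h7 := card_le_univ (X ∪ Y)
    rw [card_union_of_disjoint hd] at h6 h7
    omega
  rcases Z.eq_empty_or_nonempty with h0 | ⟨z, hz⟩
  · have hAadj' := hAadj (by simp [h0])
    obtain ⟨y, hy, hwy⟩ := hAadj' w (hWA hw)
    -- y ∈ Y has at most k + 1 neighbours in A and |W| > k + 1; a vertex x not adjacent to y must
    -- have a different neighbour in Y.
    obtain ⟨x, hx, hxy⟩ : ∃ x ∈ W, ¬ G.Adj y x := by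
      by_contra! hc
      have : W.card ≤ degOn G A y := by
        classical
        exact card_le_card fun x hx => mem_filter.2 ⟨hWA hx, hc x hx⟩
      have := hY y hy
      omega
    obtain ⟨y', hy', hxy'⟩ := hAadj' x (hWA hx)
    exact ⟨w, x, y, y', hAY _ (hWA hw), hAY _ (hWA hx), hy, hy', by rintro rfl; exact hxy hwy.symm,
      by rintro rfl; exact hxy hxy'.symm, hwy, hxy', fun i => ⟨hWf w hw i, hWf x hx i⟩⟩
  · obtain ⟨x, hxz, hxY, hxf, y, hy, hxy⟩ : ∃ x, x ≠ z ∧ x ∉ Y ∧ (∀ i, f i ≠ x) ∧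
        ∃ y ∈ Y, G.Adj x y := by
      by_cases hZ1 : Z.card ≤ 1
      · refine ⟨w, ?_, hAY w (hWA hw), hWf w hw, hAadj hZ1 w (hWA hw)⟩
        rintro rfl
        exact (hZ w hz).1 (hAX (hWA hw))
      · obtain ⟨x, hx, hxz⟩ := exists_mem_ne (by omega : 1 < Z.card) z
        obtain ⟨y, hy, hxy⟩ := exists_adj_of_degOn_pos
          (by have := hX x (hZ x hx).1; omega : 0 < degOn G B x)
        exact ⟨x, hxz, (hZ x hx).2, hZf x hx, y, hBY hy, hxy⟩
    obtain ⟨q, hq, hqy, hzq⟩ := exists_adj_ne_of_one_lt_degOn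
      (by have := hX z (hZ z hz).1; omega : 1 < degOn G B z) y
    exact ⟨z, x, q, y, (hZ z hz).2, hxY, hBY hq, hy, hxz.symm, hqy, hzq, hxy,
      fun i => ⟨hZf z hz i, hxf i⟩⟩

theorem IsThin.exists_hamiltonianCycle [DecidableEq V] {A T B : Finset V} (h : IsThin G k A T B)
    (hG : IsKConnected k G) (hXY : (sparseTo G k B).card ≤ (sparseTo G k A).card) :
    ∃ (v : V) (H : G.Walk v v), H.IsHamiltonianCycle ∧
      IsKConnected k (G.deleteEdges H.edgeSet) := by
  have hd := h.disjoint_sparseTo hdeg hn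
  obtain ⟨f, g, hfi, hgi, hfg⟩ := h.exists_matching hdeg hn hG
  obtain ⟨p₁, p₂, q₁, q₂, hp₁, hp₂, hq₁, hq₂, hp, hq, h₁, h₂, hf⟩ :=
    h.exists_disjoint_edges hdeg hn hXY (Nat.sub_le _ _) f (fun i => (hfg i).1)
  have hAX : A ⊆ sparseTo G k B := h.left_subset
  have hBY : B ⊆ sparseTo G k A := h.symm.left_subset
  -- Z is placed on the side of A, so the vertex set splits into X ∪ Z and Y.
  obtain ⟨p, hpp, hps⟩ := h.exists_ham_path_on hdeg hn (P := (sparseTo G k A)ᶜ)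
    (fun a ha => mem_compl.2 (disjoint_left.1 hd (hAX ha)))
    (disjoint_compl_right.mono_left hBY) disjoint_compl_left
    (mem_compl.2 hp₁) (mem_compl.2 hp₂) hp
  obtain ⟨q, hqp, hqs⟩ := h.symm.exists_ham_path_on hdeg hn (P := sparseTo G k A)
    hBY (hd.mono_left hAX) hd.symm hq₂ hq₁ hq.symm
  obtain ⟨v, H, hH, hHe⟩ := exists_hamiltonianCycle_of_paths (by omega) hpp hqp hps
    (fun w => by rw [hqs, mem_compl, not_not]) h₁ h₂
  refine ⟨v, H, hH, isKConnected_of_forall (by omega) fun A' T' B' h' hAB => ?_⟩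
  by_contra! hlt
  have ht : IsThin G k A' T' B' := ⟨h', hlt, fun a ha => degOn_le_two_of_deleteEdges hH (hAB a ha),
    fun b hb => degOn_le_two_of_deleteEdges hH fun a ha hba => hAB a ha b hb hba.symm⟩
  have key : ∀ A' B' : Finset V, IsThin G k A' T' B' → Disjoint A B' → Disjoint B A' →
      (∀ a ∈ A', ∀ b ∈ B', ¬ (G.deleteEdges H.edgeSet).Adj a b) → False := by
    intro A' B' ht hAB' hBA' hcut
    have hA' : A' ⊆ sparseTo G k B := ht.subset_of_disjoint hBA'
    have hB' : B' ⊆ sparseTo G k A := ht.symm.subset_of_disjoint hAB'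
    have hZ : (sparseTo G k B ∪ sparseTo G k A)ᶜ ⊆ T' := by
      intro v hv
      rw [mem_compl, mem_union, not_or] at hv
      exact ((ht.cover v).resolve_left fun h => hv.1 (hA' h)).resolve_right fun h => hv.2 (hB' h)
    -- A matching edge missing T' would join A' to B' in G - E(H), since H crosses only at `p₁` and
    -- `p₂`, which are not matched.
    have hmem : ∀ i, f i ∉ T' → g i ∈ T' := by
      intro i hfT
      by_contra hgT
      obtain ⟨hfX, hgY, hadj⟩ := hfg i
      have hfA : f i ∈ A' := by
        rcases ht.cover (f i) with h | h | h
        · exact h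
        · exact absurd h hfT
        · exact absurd (hB' h) (disjoint_left.1 hd hfX)
      have hgB : g i ∈ B' := by
        rcases ht.cover (g i) with h | h | h
        · exact absurd (hA' h) (disjoint_right.1 hd hgY)
        · exact absurd h hgT
        · exact h
      refine hcut _ hfA _ hgB ?_
      rw [SimpleGraph.deleteEdges_adj]
      refine ⟨hadj, fun he => ?_⟩
      rcases hHe _ (mem_compl.2 (disjoint_left.1 hd hfX)) _ (by simpa using hgY) he with h | h
      · exact (hf i).1 h
      · exact (hf i).2 h
    -- One end of each matching edge lies in T' \ Z, which gives k - |Z| ≤ |T'| - |Z|.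
    have hcard := card_le_card_of_injOn (s := univ)
      (t := T' \ (sparseTo G k B ∪ sparseTo G k A)ᶜ)
      (fun i => if f i ∈ T' then f i else g i) (fun i _ => ?_) (fun i _ j _ hij => ?_)
    · rw [card_sdiff_of_subset hZ, card_univ, Fintype.card_fin] at hcard
      have := card_le_card hZ
      omega
    · have := hfg i
      have := hmem i
      by_cases hi : f i ∈ T' <;> simp [hi] <;> tauto
    · have hne : ∀ i j, f i ≠ g j := fun i j hij =>
        disjoint_left.1 hd (hfg i).1 (hij ▸ (hfg j).2.1)
      by_cases hi : f i ∈ T' <;> by_cases hj : f j ∈ T' <;> simp only [hi, hj, if_true, if_false] at hij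
      · exact hfi hij
      · exact absurd hij (hne _ _)
      · exact absurd hij.symm (hne _ _)
      · exact hgi hij
  rcases h.compare hdeg hn ht with hc | hc
  · exact key A' B' ht hc.1 hc.2 hAB
  · exact key B' A' ht.symm hc.1 hc.2 fun b hb a ha hba => hAB a ha b hb hba.symm

theorem exists_hamiltonianCycle_isKConnected [DecidableEq V] (hG : IsKConnected k G) :
    ∃ (v : V) (H : G.Walk v v), H.IsHamiltonianCycle ∧
      IsKConnected k (G.deleteEdges H.edgeSet) := by
  by_cases hthin : ∃ A T B, IsThin G k A T B
  · obtain ⟨A, T, B, h⟩ := hthin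
    rcases le_total (sparseTo G k B).card (sparseTo G k A).card with hle | hle
    · exact h.exists_hamiltonianCycle hdeg hn hG hle
    · exact h.symm.exists_hamiltonianCycle hdeg hn hG hle
  · obtain ⟨a, b, p, hp, hall, hba, -⟩ := hamThrough_of_dirac G (by omega) hdeg
    have hH := isHamiltonianCycle_cons (by omega) hp hall hba
    refine ⟨_, _, hH, isKConnected_of_forall (by omega) fun A T B h hAB => ?_⟩
    by_contra! hlt
    exact hthin ⟨A, T, B, h, hlt, fun a ha => degOn_le_two_of_deleteEdges hH (hAB a ha),
      fun b hb => degOn_le_two_of_deleteEdges hH fun a ha hba => hAB a ha b hb hba.symm⟩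

end Main

end DiracConn

theorem theorem1p4 {V : Type*} [Fintype V] [DecidableEq V]
    (G : SimpleGraph V) [DecidableRel G.Adj] (k : ℕ) (hk : 2 ≤ k)
    (hG : DiracConn.IsKConnected k G)
    (hn : 6 * (k : ℤ) + 12 - 2 * ⌈((k : ℚ) - 2) / (k : ℚ)⌉ ≤ (Fintype.card V : ℤ))
    (hdeg : (Fintype.card V : ℚ) / 2 ≤ (G.minDegree : ℚ)) :
    ∃ (v : V) (H : G.Walk v v), H.IsHamiltonianCycle ∧
      DiracConn.IsKConnected k (G.deleteEdges H.edgeSet) := by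
  refine DiracConn.exists_hamiltonianCycle_isKConnected (fun v => ?_) ?_ hG
  · have h1 : DiracConn.degOn G Finset.univ v = G.degree v := by
      rw [← G.card_neighborFinset_eq_degree, DiracConn.degOn]
      congr 1
      ext w
      simp
    have h2 : (G.minDegree : ℚ) ≤ G.degree v := by exact_mod_cast G.minDegree_le_degree v
    rw [h1]
    have : (Fintype.card V : ℚ) ≤ 2 * G.degree v := by linarith
    exact_mod_cast this
  · have hk0 : (0 : ℚ) < k := by exact_mod_cast (by omega : 0 < k)
    -- Only this upper bound on the ceiling matters: it yields n ≥ 6k + 10.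
    have : ⌈((k : ℚ) - 2) / (k : ℚ)⌉ ≤ 1 := by
      rw [Int.ceil_le, div_le_iff₀ hk0]
      push_cast
      linarith
    omega
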